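/- Let $n\ge 2$ and let $X=\overline{nK_2}$ be the cocktail party graph, i.e. the complement of the disjoint union of $n$ copies of $K_2$. Let $H=D^{-1/2}AD^{-1/2}$ be its normalized adjacency matrix, where $A$ is the adjacency matrix and $D$ the diagonal degree matrix of $X$ (so $H=\frac{1}{2n-2}A$). Let $W=(w_{ab})$ be any complex matrix indexed by the vertices of $X$ such that $W\circ W^*=H$ and $W\circ\overline W$ is row-stochastic, where $\circ$ is the entrywise product and $W^*$ the conjugate transpose. The quantum walk with respect to $(X,W)$ acts on complex-valued functions on the arcs of $X$ (the ordered pairs $(a,b)$ of adjacent vertices) by the transition matrix \[U=R\,(2N_t^*N_t-I),\] where $R$ is the permutation matrix that maps each arc $(a,b)$ to $(b,a)$, and $N_t$ is the matrix with rows indexed by vertices and columns by arcs, whose entry at $(u,(a,b))$ is $w_{ab}$ if $u=a$ and $0$ otherwise. Then $U$ is unitary, and for any two antipodal vertices $a,b$ of $X$ (vertices whose distance equals the diameter of $X$, i.e. the two vertices of one copy of $K_2$) there is pretty good state transfer between $a$ and $b$: there is $\gamma\in\mathbb C$ with $|\gamma|=1$ such that for every $\epsilon>0$ there is $t\in\mathbb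 Z$ with \[\bigl\|U^tN_t^*e_a-\gamma N_t^*e_b\bigr\|<\epsilon ,\] where $e_a$ is the characteristic vector of the vertex $a$ and $\|\cdot\|$ is the Euclidean norm (and likewise with $a$ and $b$ exchanged). -/

import Mathlib

open scoped Matrix

noncomputable section

namespace QuantumWalk

variable {V : Type*} [Fintype V] [DecidableEq V]

/-- `n K₂`, the disjoint union of `n` copies of `K₂`: the `i`-th copy has the two vertices `(i, 0)` and `(i, 1)`. -/
def disjointEdges (n : ℕ) : SimpleGraph (Fin n × Fin 2) where
  Adj a b := a.1 = b.1 ∧ a.2 ≠ b.2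
  symm := ⟨fun _ _ h => ⟨h.1.symm, h.2.symm⟩⟩
  loopless := ⟨fun _ h => h.2 rfl⟩

instance (n : ℕ) : DecidableRel (disjointEdges n).Adj :=
  fun a b => inferInstanceAs (Decidable (a.1 = b.1 ∧ a.2 ≠ b.2))

/-- The cocktail party graph, the complement of `n K₂`. -/
abbrev cocktailParty (n : ℕ) : SimpleGraph (Fin n × Fin 2) := (disjointEdges n)ᶜ

/-- Two vertices are antipodal if their distance is the diameter of the graph. -/
def IsAntipodal (X : SimpleGraph V) (a b : V) : Prop := X.dist a b = X.diam

/-- The normalized adjacency matrix `D^{-1/2} A D^{-1/2}`. -/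
def normalizedAdjMatrix (X : SimpleGraph V) [DecidableRel X.Adj] : Matrix V V ℂ :=
  Matrix.of fun a b =>
    if X.Adj a b then ((1 / Real.sqrt ((X.degree a : ℝ) * (X.degree b : ℝ)) : ℝ) : ℂ) else 0

/-- `W` is normalized: the entrywise product `W ∘ W̄`, whose entries are the nonnegative reals
`|w_ab|²`, is row-stochastic. -/
def IsNormalized (W : Matrix V V ℂ) : Prop :=
  (W ⊙ W.map (starRingEnd ℂ)) *ᵥ (1 : V → ℂ) = 1

/-- The arc-reversal permutation matrix `R`; the arcs are the darts of `X`. -/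
def arcReversal (X : SimpleGraph V) : Matrix X.Dart X.Dart ℂ :=
  Matrix.of fun d e => if d = e.symm then 1 else 0

/-- The weighted tail-arc incidence matrix `N_t`; the tail of the arc `d = (a, b)` is `d.fst = a`. -/
def tailIncidence (X : SimpleGraph V) (W : Matrix V V ℂ) : Matrix V X.Dart ℂ :=
  Matrix.of fun u d => if u = d.fst then W d.fst d.snd else 0

/-- The transition matrix `U = R (2 N_t^* N_t - I)`. -/
def transitionMatrix (X : SimpleGraph V) (W : Matrix V V ℂ) [DecidableRel X.Adj] :
    Matrix X.Dart X.Dart ℂ :=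
  arcReversal X * ((2 : ℂ) • ((tailIncidence X W)ᴴ * tailIncidence X W) - 1)

/-- The state `N_t^* e_a`, concentrated on the outgoing arcs of `a`. -/
def vertexState (X : SimpleGraph V) (W : Matrix V V ℂ) (a : V) : X.Dart → ℂ :=
  (tailIncidence X W)ᴴ *ᵥ Pi.single a 1

/-- Pretty good state transfer from `x` to `y` under the unitary matrix `U`, in integer time and
with respect to the Euclidean norm. -/
def PrettyGoodStateTransfer {ι : Type*} [Fintype ι] [DecidableEq ι] (U : Matrix ι ι ℂ)
    (x y : ι → ℂ) : Prop :=
  U ∈ Matrix.unitaryGroup ι ℂ ∧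
    ∃ γ : ℂ, ‖γ‖ = 1 ∧ ∀ ε : ℝ, 0 < ε → ∃ t : ℤ, ‖WithLp.toLp 2 ((U ^ t) *ᵥ x - γ • y)‖ < ε

end QuantumWalk

end

/-!
Write `L = N_t^*`. Since the cocktail party graph is regular, the two conditions on `W` force
`|w_ab|² = H_ab` (`mul_star_eq_normalizedAdjMatrix`): comparing the sums of `|w_ab|²` and of
`|w_ab| |w_ba|` gives `∑ (|w_ab| - |w_ba|)² = 0`. Hence `L` is an isometry, `U` is unitary, and
`L^* R L = H`.

The walk satisfies `U L = R L` and `U R L = 2 R L H - L`. So if `H v = cos α • v`, the orbit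
`U^t L v` obeys the Chebyshev recurrence with parameter `cos α`, and
`‖U^t L v - σ L v‖² = 2 (1 - σ cos (t α)) ‖L v‖²` for `σ = ±1`
(`norm_transitionMatrix_pow_sub_sq`).

For the cocktail party graph, `H` has the eigenvalues `1`, `0` and `-1 / (n - 1)`, and for antipodal
`a`, `b` the vectors `e_a`, `e_b` have the same components for `1` and `-1 / (n - 1)` and opposite
components for `0`. It therefore suffices to find `t ≡ 2 (mod 4)`, which makes
`cos (t π / 2) = -1`, with `cos (t α)` close to `1`, where `cos α = -1 / (n - 1)`. By Niven's
theorem `α` is an irrational multiple of `π` unless `n ≤ 3`, and then a density argument applies;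
for `n = 2` and `n = 3` the times `2` and `6` are exact (`exists_nat_cos_near_one`).
-/

noncomputable section

open scoped Matrix

namespace QuantumWalk

/-! ### Three-term recurrences and times congruent to two modulo four -/

/-- A sequence `u` of vectors of constant norm that satisfies the Chebyshev recurrence for `cos α`
moves along a cosine wave as seen from `u 0`: `⟪u 0, u t⟫ = cos (t α) ‖u 0‖²`. This needs no
diagonalization, so it also covers the degenerate angles with `sin α = 0`. -/
theorem norm_sub_smul_sq_of_chebyshev {F : Type*} [NormedAddCommGroup F] [InnerProductSpace ℂ F]
    {u : ℕ → F} {α : ℝ} (hnorm : ∀ t, ‖u t‖ = ‖u 0‖)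
    (hrec : ∀ t, u (t + 2) = ((2 * Real.cos α : ℝ) : ℂ) • u (t + 1) - u t)
    (hinner : inner ℂ (u 0) (u 1) = ((Real.cos α * ‖u 0‖ ^ 2 : ℝ) : ℂ))
    {σ : ℝ} (hσ : σ ^ 2 = 1) (t : ℕ) :
    ‖u t - (σ : ℂ) • u 0‖ ^ 2 = 2 * (1 - σ * Real.cos (t * α)) * ‖u 0‖ ^ 2 := by
  have key : ∀ t : ℕ, inner ℂ (u 0) (u t) = ((Real.cos (t * α) * ‖u 0‖ ^ 2 : ℝ) : ℂ) ∧
      inner ℂ (u 0) (u (t + 1)) = ((Real.cos ((t + 1 : ℕ) * α) * ‖u 0‖ ^ 2 : ℝ) : ℂ) := by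
    intro t
    induction t with
    | zero =>
      refine ⟨?_, by simpa using hinner⟩
      rw [inner_self_eq_norm_sq_to_K]
      simp
    | succ t ih =>
      refine ⟨ih.2, ?_⟩
      rw [hrec, inner_sub_right, inner_smul_right, ih.1, ih.2]
      have h : Real.cos ((t + 1 + 1 : ℕ) * α)
          = 2 * Real.cos α * Real.cos ((t + 1 : ℕ) * α) - Real.cos (t * α) := by
        have h1 : ((t + 1 + 1 : ℕ) : ℝ) * α = (t + 1 : ℕ) * α + α := by push_cast; ring
        have h2 : (t : ℝ) * α = (t + 1 : ℕ) * α - α := by push_cast; ring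
        rw [h1, h2, Real.cos_add, Real.cos_sub]
        ring
      rw [h]
      push_cast
      ring
  have hre : (inner ℂ (u t) ((σ : ℂ) • u 0)).re = σ * (Real.cos (t * α) * ‖u 0‖ ^ 2) := by
    rw [inner_smul_right, ← inner_conj_symm, (key t).1, Complex.conj_ofReal, ← Complex.ofReal_mul,
      Complex.ofReal_re]
  have hns : ‖(σ : ℂ) • u 0‖ ^ 2 = ‖u 0‖ ^ 2 := by
    rw [norm_smul, mul_pow, Complex.norm_real, Real.norm_eq_abs, sq_abs, hσ, one_mul]
  have h := @norm_sub_sq ℂ F _ _ _ (u t) ((σ : ℂ) • u 0)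
  rw [RCLike.re_eq_complex_re, hre, hns, hnorm t] at h
  rw [h]
  ring

/-- If `α / π` is irrational, the multiples of `4 α` are dense modulo `2 π`, hence come close
to `-2 α`. -/
theorem exists_cos_four_mul_add_two_of_irrational {α : ℝ} (hα : Irrational (α / Real.pi)) {δ : ℝ}
    (hδ : 0 < δ) : ∃ s : ℤ, 1 - Real.cos ((4 * s + 2 : ℤ) * α) < δ := by
  have hirr : Irrational (4 * α / (2 * Real.pi)) := by
    have : 4 * α / (2 * Real.pi) = (2 : ℕ) * (α / Real.pi) := by
      push_cast; field_simp; ring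
    rw [this]
    exact hα.natCast_mul two_ne_zero
  have hdense := dense_addSubgroupClosure_pair_iff.2 hirr
  have hopen : IsOpen {x : ℝ | 1 - Real.cos (x + 2 * α) < δ} :=
    isOpen_lt (by fun_prop) continuous_const
  obtain ⟨x, hx, hxmem⟩ := hdense.exists_mem_open hopen ⟨-(2 * α), by simpa using hδ⟩
  obtain ⟨s, k, rfl⟩ := AddSubgroup.mem_closure_pair.1 hx
  refine ⟨s, ?_⟩
  have h : s • (4 * α) + k • (2 * Real.pi) + 2 * α
      = (4 * s + 2 : ℤ) * α + k * (2 * Real.pi) := by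
    simp only [zsmul_eq_mul]; push_cast; ring
  simpa only [Set.mem_ofPred_eq, h, Real.cos_add_int_mul_two_pi] using hxmem

/-- For `cos α = -1 / (n - 1)` the rotation by `α` returns arbitrarily close to the identity at
times congruent to `2` modulo `4`. By Niven's theorem `α / π` is irrational unless `n = 2` or
`n = 3`, where the rotation has order `2`, respectively `3`. -/
theorem exists_nat_cos_near_one {n : ℕ} (hn : 2 ≤ n) {α : ℝ}
    (hα : Real.cos α = -1 / ((n : ℝ) - 1)) {δ : ℝ} (hδ : 0 < δ) :
    ∃ t : ℕ, t % 4 = 2 ∧ 1 - Real.cos (t * α) < δ := by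
  suffices h : ∃ s : ℤ, 1 - Real.cos ((4 * s + 2 : ℤ) * α) < δ by
    obtain ⟨s, hs⟩ := h
    refine ⟨(4 * s + 2).natAbs, by omega, ?_⟩
    -- The cosine is even, so a negative time may be reflected; `-2 ≡ 2` modulo `4`.
    have h1 : (((4 * s + 2).natAbs : ℕ) : ℝ) = |((4 * s + 2 : ℤ) : ℝ)| := by
      rw [Nat.cast_natAbs, Int.cast_abs]
    rw [h1]
    rcases abs_choice ((4 * s + 2 : ℤ) : ℝ) with h2 | h2 <;> rw [h2]
    · exact hs
    · rwa [neg_mul, Real.cos_neg]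
  by_cases hirr : Irrational (α / Real.pi)
  · exact exists_cos_four_mul_add_two_of_irrational hirr hδ
  have hn' : (2 : ℝ) ≤ n := by exact_mod_cast hn
  have hpos : (0 : ℝ) < n - 1 := by linarith
  have hneg : Real.cos α < 0 := by rw [hα]; exact div_neg_of_neg_of_pos (by norm_num) hpos
  obtain ⟨r, hr⟩ := exists_rat_of_not_irrational hirr
  have hniven := niven (θ := α) ⟨r, by rw [← hr]; field_simp⟩
    ⟨-1 / ((n : ℚ) - 1), by rw [hα]; push_cast; rfl⟩
  simp only [Set.mem_insert_iff, Set.mem_singleton_iff] at hniven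
  rcases hniven with h | h | h | h | h
  · refine ⟨0, ?_⟩
    have : Real.cos ((4 * 0 + 2 : ℤ) * α) = 1 := by
      rw [show (((4 * 0 + 2 : ℤ)) : ℝ) = 2 by norm_num, Real.cos_two_mul, h]
      norm_num
    rw [this]
    simpa using hδ
  · refine ⟨1, ?_⟩
    have : Real.cos ((4 * 1 + 2 : ℤ) * α) = 1 := by
      have h6 : ((4 * 1 + 2 : ℤ) : ℝ) * α = 2 * (3 * α) := by push_cast; ring
      rw [h6, Real.cos_two_mul, Real.cos_three_mul, h]
      norm_num
    rw [this]
    simpa using hδ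
  all_goals linarith

/-! ### Walks on a graph -/

section Walk

variable {V : Type*} [Fintype V]

theorem sum_dart (X : SimpleGraph V) [DecidableRel X.Adj] {M : Type*} [AddCommMonoid M]
    (f : V → V → M) :
    ∑ d : X.Dart, f d.fst d.snd = ∑ u, ∑ v, if X.Adj u v then f u v else 0 := by
  rw [← Fintype.sum_prod_type' (f := fun u v => if X.Adj u v then f u v else 0),
    ← Finset.sum_filter]
  refine Finset.sum_bij (fun d _ => d.toProd) (fun d _ => by simp)
    (fun d _ e _ h => SimpleGraph.Dart.ext _ _ h)
    (fun p hp => ⟨⟨p, by simpa using hp⟩, Finset.mem_univ _, rfl⟩) (fun d _ => rfl)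

/-- On a regular graph, `W ∘ W^* = H` and normalization force `|w_ab| = |w_ba|`: the sums of
`|w_ab|²` and of `|w_ab| |w_ba|` over all pairs both equal the number of vertices, so the sum of
`(|w_ab| - |w_ba|)²` vanishes. In particular `W` vanishes off the edges. -/
theorem mul_star_eq_normalizedAdjMatrix {X : SimpleGraph V} [DecidableRel X.Adj]
    {W : Matrix V V ℂ} {k : ℕ} (hk : 0 < k) (hreg : X.IsRegularOfDegree k)
    (hH : W ⊙ Wᴴ = normalizedAdjMatrix X) (hW : IsNormalized W) (a b : V) :
    W a b * star (W a b) = normalizedAdjMatrix X a b := by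
  have hHab : ∀ a b, normalizedAdjMatrix X a b
      = ((if X.Adj a b then 1 / (k : ℝ) else 0 : ℝ) : ℂ) := by
    intro a b
    simp only [normalizedAdjMatrix, Matrix.of_apply, hreg a, hreg b]
    rw [Real.sqrt_mul_self (Nat.cast_nonneg k)]
    split_ifs <;> simp
  have hprod : ∀ a b, ‖W a b‖ * ‖W b a‖ = if X.Adj a b then 1 / (k : ℝ) else 0 := by
    intro a b
    have h := congrArg norm (congrFun (congrFun hH a) b)
    rw [Matrix.hadamard_apply, Matrix.conjTranspose_apply, norm_mul, norm_star, hHab,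
      Complex.norm_real, Real.norm_eq_abs, abs_of_nonneg (by split_ifs <;> positivity)] at h
    exact h
  have hsq : ∀ a, ∑ b, ‖W a b‖ ^ 2 = 1 := by
    intro a
    have h := congrFun hW a
    simp only [Matrix.mulVec, dotProduct, Matrix.hadamard_apply, Matrix.map_apply, Pi.one_apply,
      mul_one, Complex.mul_conj'] at h
    exact_mod_cast h
  have hrow : ∀ a, ∑ b, ‖W a b‖ * ‖W b a‖ = 1 := by
    intro a
    have hk' : (k : ℝ) ≠ 0 := by positivity
    simp only [hprod]
    rw [← Finset.sum_filter, Finset.sum_const, ← X.neighborFinset_eq_filter,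
      X.card_neighborFinset_eq_degree, hreg a, nsmul_eq_mul]
    field_simp
  have hzero : ∑ a, ∑ b, (‖W a b‖ - ‖W b a‖) ^ 2 = 0 := by
    have hcomm : ∑ a, ∑ b, ‖W b a‖ ^ 2 = ∑ a, ∑ b, ‖W a b‖ ^ 2 := Finset.sum_comm
    have hexp : ∀ a b, (‖W a b‖ - ‖W b a‖) ^ 2
        = ‖W a b‖ ^ 2 + ‖W b a‖ ^ 2 - 2 * (‖W a b‖ * ‖W b a‖) := fun a b => by ring
    simp only [hexp, Finset.sum_sub_distrib, Finset.sum_add_distrib, ← Finset.mul_sum, hcomm,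
      hsq, hrow]
    ring
  have heq : ‖W a b‖ = ‖W b a‖ := by
    have h1 := (Finset.sum_eq_zero_iff_of_nonneg
      (fun a _ => Finset.sum_nonneg fun b _ => sq_nonneg (‖W a b‖ - ‖W b a‖))).1 hzero a
        (Finset.mem_univ a)
    have h2 := (Finset.sum_eq_zero_iff_of_nonneg
      (fun b _ => sq_nonneg (‖W a b‖ - ‖W b a‖))).1 h1 b (Finset.mem_univ b)
    exact sub_eq_zero.1 (pow_eq_zero_iff two_ne_zero |>.1 h2)
  have hp := hprod a b
  rw [← heq] at hp
  rw [← starRingEnd_apply, Complex.mul_conj', hHab, ← hp]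
  push_cast
  ring

theorem arcReversal_conjTranspose {V : Type*} [DecidableEq V] (X : SimpleGraph V) :
    (arcReversal X)ᴴ = arcReversal X := by
  ext d e
  have : e = d.symm ↔ d = e.symm :=
    ⟨fun h => by rw [h, SimpleGraph.Dart.symm_symm], fun h => by rw [h, SimpleGraph.Dart.symm_symm]⟩
  simp [arcReversal, this, apply_ite]

variable [DecidableEq V] (X : SimpleGraph V) [DecidableRel X.Adj] (W : Matrix V V ℂ)

theorem arcReversal_mul {m : Type*} (M : Matrix X.Dart m ℂ) (d : X.Dart) (j : m) :
    (arcReversal X * M) d j = M d.symm j := by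
  rw [Matrix.mul_apply, Finset.sum_eq_single d.symm]
  · simp [arcReversal]
  · intro e _ he
    have : d ≠ e.symm := fun h => he (by rw [h, SimpleGraph.Dart.symm_symm])
    simp [arcReversal, this]
  · simp

theorem arcReversal_mul_self : arcReversal X * arcReversal X = 1 := by
  ext d e
  rw [arcReversal_mul, Matrix.one_apply]
  simp [arcReversal, SimpleGraph.Dart.symm_involutive.injective.eq_iff]

/-- The discriminant `N_t R N_t^*` of the walk is the part of `W ∘ W^*` supported on the edges. -/
theorem tailIncidence_mul_arcReversal_mul (u v : V) :
    (tailIncidence X W * (arcReversal X * (tailIncidence X W)ᴴ)) u v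
      = if X.Adj u v then (W ⊙ Wᴴ) u v else 0 := by
  rw [Matrix.mul_apply]
  simp only [arcReversal_mul]
  have := sum_dart X (fun x y => (if u = x then W x y else 0) * star (if v = y then W y x else 0))
  refine Eq.trans ?_ (this.trans ?_)
  · rfl
  · rw [Finset.sum_eq_single u (by intro x _ hx; simp [hx.symm]) (by simp),
      Finset.sum_eq_single v (by intro x _ hx; simp [hx.symm]) (by simp)]
    simp [Matrix.hadamard_apply]

theorem tailIncidence_mul_conjTranspose (u v : V) :
    (tailIncidence X W * (tailIncidence X W)ᴴ) u v
      = if u = v then ∑ y, if X.Adj u y then W u y * star (W u y) else 0 else 0 := by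
  rw [Matrix.mul_apply]
  have := sum_dart X (fun x y => (if u = x then W x y else 0) * star (if v = x then W x y else 0))
  refine Eq.trans ?_ (this.trans ?_)
  · rfl
  · rw [Finset.sum_eq_single u (by intro x _ hx; simp [hx.symm]) (by simp)]
    by_cases h : u = v
    · simp [h]
    · simp [h, Ne.symm h]

variable {X W}

/-- Normalization of the weights on the edges makes `N_t^*` an isometry. -/
theorem tailIncidence_mul_conjTranspose_eq_one {k : ℕ} (hk : 0 < k)
    (hreg : X.IsRegularOfDegree k) (hH : W ⊙ Wᴴ = normalizedAdjMatrix X) (hW : IsNormalized W) :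
    tailIncidence X W * (tailIncidence X W)ᴴ = 1 := by
  ext u v
  rw [tailIncidence_mul_conjTranspose, Matrix.one_apply]
  congr 1
  have h := congrFun hW u
  simp only [Matrix.mulVec, dotProduct, Matrix.hadamard_apply, Matrix.map_apply, Pi.one_apply,
    mul_one, starRingEnd_apply] at h
  rw [← h]
  refine Finset.sum_congr rfl fun y _ => ?_
  have h' := mul_star_eq_normalizedAdjMatrix hk hreg hH hW u y
  split_ifs with hadj
  · rfl
  · rw [h']
    simp [normalizedAdjMatrix, hadj]

theorem discriminant_eq_normalizedAdjMatrix (hH : W ⊙ Wᴴ = normalizedAdjMatrix X) :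
    tailIncidence X W * (arcReversal X * (tailIncidence X W)ᴴ) = normalizedAdjMatrix X := by
  ext u v
  rw [tailIncidence_mul_arcReversal_mul, hH]
  by_cases h : X.Adj u v <;> simp [h, normalizedAdjMatrix]

/-- The walk is unitary, being the product of the two reflections `R` and `2 N_t^* N_t - I`. -/
theorem transitionMatrix_mem_unitaryGroup
    (hN : tailIncidence X W * (tailIncidence X W)ᴴ = 1) :
    transitionMatrix X W ∈ Matrix.unitaryGroup X.Dart ℂ := by
  refine mul_mem ?_ ?_
  · rw [Matrix.mem_unitaryGroup_iff, Matrix.star_eq_conjTranspose, arcReversal_conjTranspose,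
      arcReversal_mul_self]
  · rw [Matrix.mem_unitaryGroup_iff, Matrix.star_eq_conjTranspose]
    set N := tailIncidence X W
    have hP : Nᴴ * N * (Nᴴ * N) = Nᴴ * N := by
      rw [Matrix.mul_assoc, ← Matrix.mul_assoc N, hN, Matrix.one_mul]
    have hadj : ((2 : ℂ) • (Nᴴ * N) - 1)ᴴ = (2 : ℂ) • (Nᴴ * N) - 1 := by
      simp [Matrix.conjTranspose_sub, Matrix.conjTranspose_smul, Matrix.conjTranspose_mul]
    rw [hadj, Matrix.sub_mul, Matrix.mul_sub, Matrix.smul_mul, Matrix.mul_smul, hP]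
    simp only [Matrix.mul_one, Matrix.one_mul]
    module

theorem transitionMatrix_mul_conjTranspose
    (hN : tailIncidence X W * (tailIncidence X W)ᴴ = 1) :
    transitionMatrix X W * (tailIncidence X W)ᴴ = arcReversal X * (tailIncidence X W)ᴴ := by
  rw [transitionMatrix, Matrix.mul_assoc, Matrix.sub_mul, Matrix.smul_mul,
    Matrix.mul_assoc _ᴴ, hN]
  congr 1
  simp only [Matrix.mul_one, Matrix.one_mul]
  module

theorem transitionMatrix_mul_arcReversal_mul (hH : W ⊙ Wᴴ = normalizedAdjMatrix X) :
    transitionMatrix X W * (arcReversal X * (tailIncidence X W)ᴴ)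
      = (2 : ℂ) • (arcReversal X * (tailIncidence X W)ᴴ * normalizedAdjMatrix X)
        - (tailIncidence X W)ᴴ := by
  rw [transitionMatrix, Matrix.mul_assoc, Matrix.sub_mul, Matrix.smul_mul, Matrix.mul_assoc _ᴴ,
    discriminant_eq_normalizedAdjMatrix hH, Matrix.mul_sub, Matrix.mul_smul, Matrix.one_mul,
    ← Matrix.mul_assoc (arcReversal X) (arcReversal X), arcReversal_mul_self, Matrix.one_mul,
    Matrix.mul_assoc]

/-- The lift to the arcs of an eigenvector of `H` with eigenvalue `cos α` is rotated by the angle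
`α` at each step of the walk. -/
theorem norm_transitionMatrix_pow_sub_sq (hN : tailIncidence X W * (tailIncidence X W)ᴴ = 1)
    (hH : W ⊙ Wᴴ = normalizedAdjMatrix X) {α : ℝ} {v : V → ℂ}
    (hv : normalizedAdjMatrix X *ᵥ v = (Real.cos α : ℂ) • v) {σ : ℝ} (hσ : σ ^ 2 = 1) (t : ℕ) :
    ‖WithLp.toLp 2 (transitionMatrix X W ^ t *ᵥ ((tailIncidence X W)ᴴ *ᵥ v)
        - (σ : ℂ) • ((tailIncidence X W)ᴴ *ᵥ v))‖ ^ 2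
      = 2 * (1 - σ * Real.cos (t * α)) * ‖WithLp.toLp 2 ((tailIncidence X W)ᴴ *ᵥ v)‖ ^ 2 := by
  have hU := transitionMatrix_mem_unitaryGroup hN
  have h1 := transitionMatrix_mul_conjTranspose hN
  have h2 := transitionMatrix_mul_arcReversal_mul hH
  have h3 := discriminant_eq_normalizedAdjMatrix hH
  set U := transitionMatrix X W
  set N := tailIncidence X W
  set R := arcReversal X
  set H := normalizedAdjMatrix X
  set x := Nᴴ *ᵥ v with hx
  have hUx : U *ᵥ x = (R * Nᴴ) *ᵥ v := by rw [hx, Matrix.mulVec_mulVec, h1]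
  have hUUx : U *ᵥ (U *ᵥ x) = ((2 * Real.cos α : ℝ) : ℂ) • (U *ᵥ x) - x := by
    rw [hUx, Matrix.mulVec_mulVec, h2, Matrix.sub_mulVec, Matrix.smul_mulVec,
      ← Matrix.mulVec_mulVec, hv, Matrix.mulVec_smul, smul_smul]
    push_cast
    rfl
  have hdot : ∀ (M : Matrix X.Dart V ℂ), (M *ᵥ v) ⬝ᵥ star x = ((N * M) *ᵥ v) ⬝ᵥ star v := by
    intro M
    rw [hx, Matrix.star_mulVec, Matrix.conjTranspose_conjTranspose, dotProduct_comm,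
      ← Matrix.dotProduct_mulVec, Matrix.mulVec_mulVec, dotProduct_comm]
  have hinner : (U *ᵥ x) ⬝ᵥ star x = (Real.cos α : ℂ) * (x ⬝ᵥ star x) := by
    rw [hUx, hdot, h3, hv, smul_dotProduct, smul_eq_mul]
    congr 1
    rw [hx, hdot, hN, Matrix.one_mulVec]
  have hself : ∀ y : X.Dart → ℂ, y ⬝ᵥ star y = ((‖WithLp.toLp 2 y‖ ^ 2 : ℝ) : ℂ) := by
    intro y
    rw [← EuclideanSpace.inner_toLp_toLp, inner_self_eq_norm_sq_to_K]
    push_cast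
    rfl
  have hnorm : ∀ t, ‖WithLp.toLp 2 (U ^ t *ᵥ x)‖ = ‖WithLp.toLp 2 x‖ := by
    intro t
    have hUt : (U ^ t)ᴴ * U ^ t = 1 :=
      Matrix.mem_unitaryGroup_iff'.1 (pow_mem hU t)
    have h : (U ^ t *ᵥ x) ⬝ᵥ star (U ^ t *ᵥ x) = x ⬝ᵥ star x := by
      rw [Matrix.star_mulVec, dotProduct_comm, ← Matrix.dotProduct_mulVec, Matrix.mulVec_mulVec,
        hUt, Matrix.one_mulVec, dotProduct_comm]
    rw [hself, hself, Complex.ofReal_inj] at h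
    exact (sq_eq_sq₀ (norm_nonneg _) (norm_nonneg _)).1 h
  have := norm_sub_smul_sq_of_chebyshev (u := fun t => WithLp.toLp 2 (U ^ t *ᵥ x)) (α := α)
    (by simpa using hnorm) ?_ ?_ hσ t
  · simpa using this
  · intro t
    have h : U ^ (t + 2) *ᵥ x
        = ((2 * Real.cos α : ℝ) : ℂ) • (U ^ (t + 1) *ᵥ x) - U ^ t *ᵥ x := by
      rw [pow_add, ← Matrix.mulVec_mulVec, pow_two, ← Matrix.mulVec_mulVec, hUUx,
        Matrix.mulVec_sub, Matrix.mulVec_smul, Matrix.mulVec_mulVec, pow_succ]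
    simp only [h, WithLp.toLp_sub, WithLp.toLp_smul]
  · simp only [pow_zero, pow_one, Matrix.one_mulVec]
    rw [EuclideanSpace.inner_toLp_toLp, hinner, hself]
    push_cast
    rfl

end Walk

/-! ### The cocktail party graph -/

theorem cocktailParty_adj {n : ℕ} {u v : Fin n × Fin 2} :
    (cocktailParty n).Adj u v ↔ u.1 ≠ v.1 := by
  rw [SimpleGraph.compl_adj]
  constructor
  · rintro ⟨h1, h2⟩ h
    exact h2 ⟨h, fun h' => h1 (Prod.ext h h')⟩
  · exact fun h => ⟨fun h' => h (congrArg Prod.fst h'), fun h' => h h'.1⟩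

theorem cocktailParty_isRegularOfDegree (n : ℕ) :
    (cocktailParty n).IsRegularOfDegree (2 * (n - 1)) := by
  intro u
  have h : (cocktailParty n).neighborFinset u
      = (Finset.univ.erase u.1) ×ˢ (Finset.univ : Finset (Fin 2)) := by
    ext v
    rw [SimpleGraph.mem_neighborFinset, cocktailParty_adj]
    simp [eq_comm]
  rw [← SimpleGraph.card_neighborFinset_eq_degree, h]
  simp [Finset.card_product, mul_comm]

theorem fst_eq_and_ne_of_isAntipodal {n : ℕ} (hn : 2 ≤ n) {a b : Fin n × Fin 2}
    (hab : IsAntipodal (cocktailParty n) a b) : a.1 = b.1 ∧ a ≠ b := by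
  let i : Fin n := ⟨0, by omega⟩
  let j : Fin n := ⟨1, by omega⟩
  have hij : i ≠ j := by simp [i, j]
  have : Nonempty (Fin n × Fin 2) := ⟨a⟩
  have hconn : (cocktailParty n).Connected := by
    refine SimpleGraph.Connected.mk fun u v => ?_
    by_cases huv : u.1 = v.1
    · obtain ⟨m, hm⟩ : ∃ m : Fin n, u.1 ≠ m := by
        by_cases h : u.1 = i
        · exact ⟨j, h ▸ hij⟩
        · exact ⟨i, h⟩
      have h1 : (cocktailParty n).Adj u (m, 0) := cocktailParty_adj.2 hm
      have h2 : (cocktailParty n).Adj (m, 0) v := cocktailParty_adj.2 (huv ▸ hm.symm)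
      exact h1.reachable.trans h2.reachable
    · exact (cocktailParty_adj.2 huv : (cocktailParty n).Adj u v).reachable
  have hle := SimpleGraph.dist_le_diam (SimpleGraph.connected_iff_ediam_ne_top.1 hconn)
    (u := ((i, 0) : Fin n × Fin 2)) (v := (i, 1))
  have h0 : (cocktailParty n).dist (i, 0) (i, 1) ≠ 0 := fun h => by
    simpa using hconn.dist_eq_zero_iff.1 h
  have h1 : (cocktailParty n).dist (i, 0) (i, 1) ≠ 1 := fun h => by
    simpa using cocktailParty_adj.1 (SimpleGraph.dist_eq_one_iff_adj.1 h)
  rw [← hab] at hle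
  constructor
  · by_contra h
    have := SimpleGraph.dist_eq_one_iff_adj.2 (cocktailParty_adj.2 h)
    omega
  · rintro rfl
    rw [SimpleGraph.dist_self] at hle
    omega

theorem normalizedAdjMatrix_cocktailParty {n : ℕ} (u v : Fin n × Fin 2) :
    normalizedAdjMatrix (cocktailParty n) u v
      = if u.1 = v.1 then 0 else 1 / (2 * (n - 1 : ℕ) : ℂ) := by
  simp only [normalizedAdjMatrix, Matrix.of_apply, cocktailParty_isRegularOfDegree n u,
    cocktailParty_isRegularOfDegree n v, cocktailParty_adj]
  rw [Real.sqrt_mul_self (Nat.cast_nonneg _)]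
  by_cases h : u.1 = v.1 <;> simp [h]

theorem normalizedAdjMatrix_cocktailParty_mulVec_one {n : ℕ} (hn : 2 ≤ n) :
    normalizedAdjMatrix (cocktailParty n) *ᵥ 1 = 1 := by
  ext u
  have hk : (((n - 1 : ℕ) : ℂ)) ≠ 0 := by
    rw [Nat.cast_ne_zero]; omega
  have h : ∀ v, normalizedAdjMatrix (cocktailParty n) u v
      = if (cocktailParty n).Adj u v then 1 / (2 * (n - 1 : ℕ) : ℂ) else 0 := by
    intro v
    simp only [normalizedAdjMatrix_cocktailParty, cocktailParty_adj]
    by_cases h : u.1 = v.1 <;> simp [h]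
  simp only [Matrix.mulVec, dotProduct, Pi.one_apply, mul_one, h]
  rw [← Finset.sum_filter, Finset.sum_const, ← SimpleGraph.neighborFinset_eq_filter,
    SimpleGraph.card_neighborFinset_eq_degree, cocktailParty_isRegularOfDegree n u, nsmul_eq_mul]
  push_cast
  field_simp

theorem fst_eq_iff_eq_or_eq {n : ℕ} {a b : Fin n × Fin 2} (h : a.1 = b.1) (hne : a ≠ b)
    (u : Fin n × Fin 2) : u.1 = a.1 ↔ u = a ∨ u = b := by
  obtain ⟨i, x⟩ := a
  obtain ⟨j, y⟩ := b
  obtain ⟨k, z⟩ := u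
  have hxy : x ≠ y := fun h' => hne (Prod.ext h h')
  simp only [Prod.mk.injEq] at h ⊢
  subst h
  have : z = x ∨ z = y := by omega
  tauto

theorem normalizedAdjMatrix_cocktailParty_mulVec_sub {n : ℕ} {a b : Fin n × Fin 2}
    (h : a.1 = b.1) :
    normalizedAdjMatrix (cocktailParty n) *ᵥ ((1 / 2 : ℂ) • (Pi.single a 1 - Pi.single b 1))
      = 0 := by
  ext u
  simp [Matrix.mulVec_smul, Matrix.mulVec_sub, normalizedAdjMatrix_cocktailParty, h]


/-- The component of `e_a` in the eigenspace for `-1 / (n - 1)`: half the indicator `e_a + e_b` of a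
copy of `K₂`, made orthogonal to the all-ones vector. On such vectors `A = J - I_n ⊗ J_2` acts as
`-2`. -/
theorem normalizedAdjMatrix_cocktailParty_mulVec_add_sub {n : ℕ} (hn : 2 ≤ n) {a b : Fin n × Fin 2}
    (h : a.1 = b.1) (hne : a ≠ b) :
    normalizedAdjMatrix (cocktailParty n) *ᵥ
        ((1 / 2 : ℂ) • (Pi.single a 1 + Pi.single b 1) - (1 / (2 * n) : ℂ) • 1)
      = (-1 / ((n : ℂ) - 1)) •
        ((1 / 2 : ℂ) • (Pi.single a 1 + Pi.single b 1) - (1 / (2 * n) : ℂ) • 1) := by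
  have hn0 : (n : ℂ) ≠ 0 := by rw [Nat.cast_ne_zero]; omega
  have hn1 : (n : ℂ) - 1 ≠ 0 := by
    rw [sub_ne_zero]; exact_mod_cast (by omega : n ≠ 1)
  have hc : ((n - 1 : ℕ) : ℂ) = n - 1 := by rw [Nat.cast_sub (by omega)]; simp
  ext u
  rw [Matrix.mulVec_sub, Matrix.mulVec_smul, Matrix.mulVec_smul, Matrix.mulVec_add,
    normalizedAdjMatrix_cocktailParty_mulVec_one hn]
  have hu := fst_eq_iff_eq_or_eq h hne u
  simp only [Pi.sub_apply, Pi.smul_apply, Pi.add_apply, Pi.one_apply, Matrix.mulVec_single_one,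
    Matrix.col_apply, normalizedAdjMatrix_cocktailParty, Pi.single_apply, ← h, hc, smul_eq_mul]
  by_cases ha : u = a
  · have hb : u ≠ b := ha ▸ hne
    rw [if_pos (hu.2 (Or.inl ha)), if_pos ha, if_neg hb]
    field_simp
    ring
  · by_cases hb : u = b
    · rw [if_pos (hu.2 (Or.inr hb)), if_neg ha, if_pos hb]
      field_simp
      ring
    · rw [if_neg (fun h' => (hu.1 h').elim ha hb), if_neg ha, if_neg hb]
      field_simp
      ring

end QuantumWalk

end

theorem mainTheorem7 (n : ℕ) (hn : 2 ≤ n)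
    (W : Matrix (Fin n × Fin 2) (Fin n × Fin 2) ℂ)
    (hH : W ⊙ Wᴴ = QuantumWalk.normalizedAdjMatrix (QuantumWalk.cocktailParty n))
    (hW : QuantumWalk.IsNormalized W)
    (a b : Fin n × Fin 2) (hab : QuantumWalk.IsAntipodal (QuantumWalk.cocktailParty n) a b) :
    QuantumWalk.PrettyGoodStateTransfer
      (QuantumWalk.transitionMatrix (QuantumWalk.cocktailParty n) W)
      (QuantumWalk.vertexState (QuantumWalk.cocktailParty n) W a)
      (QuantumWalk.vertexState (QuantumWalk.cocktailParty n) W b) := by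
  open QuantumWalk in
  obtain ⟨h, hne⟩ := fst_eq_and_ne_of_isAntipodal hn hab
  have hN := tailIncidence_mul_conjTranspose_eq_one (by omega)
    (cocktailParty_isRegularOfDegree n) hH hW
  refine ⟨transitionMatrix_mem_unitaryGroup hN, 1, norm_one, fun ε hε => ?_⟩
  have hn' : (2 : ℝ) ≤ n := by exact_mod_cast hn
  -- The angle of the rotation on the lift of the third eigenspace.
  obtain ⟨α, hα⟩ : ∃ α : ℝ, Real.cos α = -1 / ((n : ℝ) - 1) := by
    refine ⟨Real.arccos (-1 / ((n : ℝ) - 1)), Real.cos_arccos ?_ ?_⟩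
    · rw [le_div_iff₀ (by linarith)]
      linarith
    · rw [div_le_iff₀ (by linarith)]
      linarith
  -- Components of `e_a` in the eigenspaces of `H` for `1`, `0` and `-1 / (n - 1)`; those of `e_b`
  -- differ only in the sign of `v₂`.
  set v₁ : Fin n × Fin 2 → ℂ := (1 / (2 * n) : ℂ) • 1 with hv₁
  set v₂ : Fin n × Fin 2 → ℂ := (1 / 2 : ℂ) • (Pi.single a 1 - Pi.single b 1) with hv₂
  set v₃ : Fin n × Fin 2 → ℂ := (1 / 2 : ℂ) • (Pi.single a 1 + Pi.single b 1) - v₁ with hv₃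
  have hea : Pi.single a 1 = v₁ + v₂ + v₃ := by rw [hv₃, hv₂]; module
  have heb : Pi.single b 1 = v₁ - v₂ + v₃ := by rw [hv₃, hv₂]; module
  have hH₁ : normalizedAdjMatrix (cocktailParty n) *ᵥ v₁ = (Real.cos 0 : ℂ) • v₁ := by
    rw [hv₁, Matrix.mulVec_smul, normalizedAdjMatrix_cocktailParty_mulVec_one hn]
    simp
  have hH₂ : normalizedAdjMatrix (cocktailParty n) *ᵥ v₂ = (Real.cos (Real.pi / 2) : ℂ) • v₂ := by
    rw [hv₂, normalizedAdjMatrix_cocktailParty_mulVec_sub h, Real.cos_pi_div_two]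
    simp
  have hH₃ : normalizedAdjMatrix (cocktailParty n) *ᵥ v₃ = (Real.cos α : ℂ) • v₃ := by
    rw [hv₃, hv₁, normalizedAdjMatrix_cocktailParty_mulVec_add_sub hn h hne, hα]
    push_cast
    rfl
  set L := (tailIncidence (cocktailParty n) W)ᴴ with hL
  set U := transitionMatrix (cocktailParty n) W with hU
  -- At times `t ≡ 2` modulo `4` the sign of `v₂` is exactly reversed, `v₁` is fixed, and `v₃` is
  -- nearly fixed for a suitable such `t`.
  obtain ⟨t, ht, hcos⟩ := exists_nat_cos_near_one hn hα
    (δ := ε ^ 2 / (2 * (‖WithLp.toLp 2 (L *ᵥ v₃)‖ ^ 2 + 1))) (by positivity)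
  have hn₁ := norm_transitionMatrix_pow_sub_sq hN hH hH₁ (σ := 1) (by norm_num) t
  have hn₂ := norm_transitionMatrix_pow_sub_sq hN hH hH₂ (σ := -1) (by norm_num) t
  have hn₃ := norm_transitionMatrix_pow_sub_sq hN hH hH₃ (σ := 1) (by norm_num) t
  rw [← hL, ← hU] at hn₁ hn₂ hn₃
  have hcos₂ : Real.cos (t * (Real.pi / 2)) = -1 := by
    obtain ⟨s, rfl⟩ : ∃ s, t = 4 * s + 2 := ⟨t / 4, by omega⟩
    have : ((4 * s + 2 : ℕ) : ℝ) * (Real.pi / 2) = Real.pi + s * (2 * Real.pi) := by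
      push_cast; ring
    rw [this, Real.cos_add_nat_mul_two_pi, Real.cos_pi]
  have hz₁ : U ^ t *ᵥ (L *ᵥ v₁) - L *ᵥ v₁ = 0 := by
    rw [mul_zero, Real.cos_zero, mul_one, sub_self, mul_zero, zero_mul,
      pow_eq_zero_iff two_ne_zero, norm_eq_zero, WithLp.toLp_eq_zero] at hn₁
    simpa only [Complex.ofReal_one, one_smul] using hn₁
  have hz₂ : U ^ t *ᵥ (L *ᵥ v₂) + L *ᵥ v₂ = 0 := by
    rw [hcos₂, neg_mul_neg, mul_one, sub_self, mul_zero, zero_mul,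
      pow_eq_zero_iff two_ne_zero, norm_eq_zero, WithLp.toLp_eq_zero] at hn₂
    simpa only [Complex.ofReal_neg, Complex.ofReal_one, neg_smul, one_smul, sub_neg_eq_add]
      using hn₂
  have hsplit : U ^ t *ᵥ vertexState (cocktailParty n) W a
      - (1 : ℂ) • vertexState (cocktailParty n) W b
      = U ^ t *ᵥ (L *ᵥ v₃) - ((1 : ℝ) : ℂ) • (L *ᵥ v₃) := by
    rw [vertexState, vertexState, ← hL, hea, heb]
    simp only [Matrix.mulVec_add, Matrix.mulVec_sub]
    rw [← sub_eq_zero, ← add_zero (0 : (cocktailParty n).Dart → ℂ)]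
    nth_rewrite 1 [← hz₁]
    rw [← hz₂]
    push_cast
    module
  refine ⟨t, ?_⟩
  rw [zpow_natCast, hsplit]
  refine lt_of_pow_lt_pow_left₀ 2 hε.le ?_
  rw [hn₃, one_mul]
  rw [lt_div_iff₀ (by positivity)] at hcos
  have hnn : 0 ≤ 1 - Real.cos (t * α) := by linarith [Real.cos_le_one (t * α)]
  nlinarith
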